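/- All algebras are non-empty algebras of a fixed algebraic language. For an algebra $\mathbf{B}$, let $\mathbb{ISP}(\mathbf{B})$ be the class of isomorphic copies of subalgebras of powers $\mathbf{B}^I$ (the empty index set $I$ is allowed). Let $\mathbf{M}$ be a finite algebra and $\mathcal{A}=\mathbb{ISP}(\mathbf{M})$. Let $\underset{\sim}{\mathbf{M}}=(M;G,H,R,\mathcal{T})$ be an alter ego of $\mathbf{M}$: $\mathcal{T}$ is the discrete topology, $G$ is a set of homomorphisms $\mathbf{M}^n\to\mathbf{M}$ ($n\ge 0$), $H$ is a set of partial operations that are homomorphisms from subalgebras of $\mathbf{M}^n$ to $\mathbf{M}$ ($n\ge 1$), and $R$ is a set of universes of subalgebras of $\mathbf{M}^n$ ($n\ge 1$). Let $\mathcal{X}$ be the category of isomorphic copies of closed substructures of non-empty powers of $\underset{\sim}{\mathbf{M}}$, together with the empty structure, with the continuous structure-preserving maps as morphisms. For $\mathbf{A}\in\mathcal{A}$ let $D(\mathbf{A})$ be the set of homomorphisms $\mathbf{A}\to\mathbf{M}$, as a closed substructure of $\underset{\sim}{\mathbf{M}}^A$; for $\mathbf{X}\in\mathcal{X}$ let $E(\mathbf{X})$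 be the set of morphisms $\mathbf{X}\to\underset{\sim}{\mathbf{M}}$, as a subalgebra of $\mathbf{M}^X$. Assume that $\underset{\sim}{\mathbf{M}}$ yields a strong duality on $\mathcal{A}$, that is, all evaluation maps $\mathbf{A}\to E(D(\mathbf{A}))$ ($\mathbf{A}\in\mathcal{A}$) and $\mathbf{X}\to D(E(\mathbf{X}))$ ($\mathbf{X}\in\mathcal{X}$) are isomorphisms, and $\underset{\sim}{\mathbf{M}}$ is injective in $\mathcal{X}$ with respect to embeddings. For finite $\mathbf{X},\mathbf{Y}\in\mathcal{X}$, a substructure $\mathbf{Z}$ of $\mathbf{X}$ is called a $\mathbf{Y}$-substructure of $\mathbf{X}$ if there are morphisms $\varphi_1,\dots,\varphi_m\colon\mathbf{Y}\to\mathbf{X}$ ($m\ge 0$) such that $\mathbf{Z}$ is the substructure of $\mathbf{X}$ generated by $\operatorname{im}\varphi_1\cup\dots\cup\operatorname{im}\varphi_m$. Ordered by inclusion, the $D(\mathbf{B})$-substructures of $D(\mathbf{B})$, for $\mathbf{B}\in\mathcal{A}$ finite, form a lattice, in which the join of two members is the substructure generated by their union. For a class $\mathcal{Q}$ of algebras,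 an algebra $\mathbf{A}$ is $\mathcal{Q}$-subdirectly irreducible if $\mathbf{A}\in\mathcal{Q}$ and whenever $\mathbf{A}$ is (up to isomorphism) a subdirect product of a (possibly empty) family of algebras in $\mathcal{Q}$, it is isomorphic to one of the components. **Corollary.** Let $\mathbf{B}\in\mathcal{A}$ be a finite algebra and let $\mathcal{Q}=\mathbb{ISP}(\mathbf{B})$. If $\mathbf{X}$ is join-irreducible in the lattice of $D(\mathbf{B})$-substructures of $D(\mathbf{B})$ (that is, $\mathbf{X}$ is not the least element and is not the join of two strictly smaller elements), then $E(\mathbf{X})$ is $\mathcal{Q}$-subdirectly irreducible. -/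

import Mathlib

open FirstOrder

universe u v w s

namespace NatDual



/-! ### Algebras, products and `ISP`

An algebraic language is a `FirstOrder.Language` without relation symbols; an algebra for it is a
nonempty type with an `L.Structure`. -/

section Algebras

variable {L : FirstOrder.Language.{v, w}}

/-- The product of a family of algebras, with pointwise operations. -/
instance piStructure {ι : Type*} {C : ι → Type*} [∀ i, L.Structure (C i)] :
    L.Structure (∀ i, C i) where
  funMap F x := fun i => FirstOrder.Language.Structure.funMap F (fun k => x k i)
  RelMap r x := ∀ i, FirstOrder.Language.Structure.RelMap r (fun k => x k i)

/-- `A ∈ ISP(B)`: the algebra `A` is isomorphic to a subalgebra of a power of `B`. The index set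
may be empty, so that `ISP(B)` contains the one-element algebras. -/
def InISP (L : FirstOrder.Language.{v, w}) (B : Type u) [L.Structure B] (A : Type u) [L.Structure A] : Prop :=
  Nonempty A ∧ ∃ (I : Type u) (S : L.Substructure (I → B)), Nonempty (A ≃[L] S)

/-- `f` exhibits `A` as a subdirect product of the algebras `C i`. -/
def IsSubdirect {A : Type u} [L.Structure A] {ι : Type u} {C : ι → Type u}
    [∀ i, L.Structure (C i)] (f : A ↪[L] (∀ i, C i)) : Prop :=
  ∀ i, Function.Surjective (fun a => f a i)

/-- `A` is `Q`-subdirectly irreducible: it belongs to the class `Q`, and whenever it is a subdirect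
product of algebras in `Q`, it is isomorphic to one of the components. The empty family of
components is allowed, so a one-element algebra is not `Q`-subdirectly irreducible. -/
def IsSubdirectlyIrreducible (Q : ∀ (C : Type u) [L.Structure C], Prop)
    (A : Type u) [L.Structure A] : Prop :=
  Q A ∧ ∀ (ι : Type u) (C : ι → Type u) [∀ i, L.Structure (C i)], (∀ i, Q (C i)) →
    ∀ f : A ↪[L] (∀ i, C i), IsSubdirect f → ∃ i, Nonempty (A ≃[L] C i)

end Algebras

/-! ### Structured topological spaces -/

/-- A type of structures: symbols for total operations (of arity `≥ 0`), partial operations and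
relations (of arity `≥ 1`). -/
structure Signature where
  G : Type s
  H : Type s
  R : Type s
  arG : G → ℕ
  arH : H → ℕ
  arR : R → ℕ
  arH_pos : ∀ h, 0 < arH h
  arR_pos : ∀ r, 0 < arR r

/-- A topological structure of type `σ`. -/
structure Space (σ : Signature.{s}) where
  carrier : Type u
  top : TopologicalSpace carrier
  op : ∀ g : σ.G, (Fin (σ.arG g) → carrier) → carrier
  pop : ∀ h : σ.H, (Fin (σ.arH h) → carrier) → Part carrier
  rel : ∀ r : σ.R, Set (Fin (σ.arR r) → carrier)

namespace Space

variable {σ : Signature.{s}}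

instance : CoeSort (Space.{u} σ) (Type u) := ⟨Space.carrier⟩

instance (X : Space.{u} σ) : TopologicalSpace X := X.top

/-- Continuous structure-preserving maps. A partial operation `h` is preserved if, whenever `h` is
defined at `x` with value `y`, it is defined at `f ∘ x` with value `f y`. -/
structure IsMorphism (X Y : Space.{u} σ) (f : X → Y) : Prop where
  continuous : Continuous f
  map_op : ∀ g x, f (X.op g x) = Y.op g (f ∘ x)
  map_pop : ∀ h x, ∀ y ∈ X.pop h x, f y ∈ Y.pop h (f ∘ x)
  map_rel : ∀ r, ∀ x ∈ X.rel r, f ∘ x ∈ Y.rel r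

/-- Isomorphisms: morphisms with a two-sided inverse morphism. -/
def IsIso (X Y : Space.{u} σ) (f : X → Y) : Prop :=
  IsMorphism X Y f ∧ ∃ g : Y → X, IsMorphism Y X g ∧
    Function.LeftInverse g f ∧ Function.RightInverse g f

/-- (Universes of) substructures: subsets closed under all total operations and under all partial
operations where these are defined. -/
@[ext]
structure Sub (X : Space.{u} σ) where
  carrier : Set X
  op_mem : ∀ g x, (∀ i, x i ∈ carrier) → X.op g x ∈ carrier
  pop_mem : ∀ h x, (∀ i, x i ∈ carrier) → ∀ y ∈ X.pop h x, y ∈ carrier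

namespace Sub

variable {X : Space.{u} σ}

/-- Substructures are ordered by inclusion. -/
instance : PartialOrder (Sub X) :=
  PartialOrder.lift Sub.carrier (fun _ _ h => Sub.ext h)

/-- A substructure as a structured space: subspace topology and restricted operations, partial
operations and relations. -/
def toSpace (Z : Sub X) : Space.{u} σ where
  carrier := Z.carrier
  top := instTopologicalSpaceSubtype
  op g x := ⟨X.op g (fun i => x i), Z.op_mem g _ (fun i => (x i).2)⟩
  pop h x := ⟨(X.pop h (fun i => x i)).Dom, fun hx =>
    ⟨(X.pop h (fun i => x i)).get hx, Z.pop_mem h _ (fun i => (x i).2) _ (Part.get_mem hx)⟩⟩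
  rel r := {x | (fun i => (x i : X)) ∈ X.rel r}

/-- The substructure `⟨S⟩` generated by a subset `S`. -/
def closure (S : Set X) : Sub X where
  carrier := {x | ∀ Z : Sub X, S ⊆ Z.carrier → x ∈ Z.carrier}
  op_mem g x hx Z hZ := Z.op_mem g x (fun i => hx i Z hZ)
  pop_mem h x hx y hy Z hZ := Z.pop_mem h x (fun i => hx i Z hZ) y hy

theorem subset_closure (S : Set X) : S ⊆ (closure S).carrier := fun _ hx _ hZ => hZ hx

theorem closure_le {S : Set X} {Z : Sub X} : closure S ≤ Z ↔ S ⊆ Z.carrier :=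
  ⟨fun h => (subset_closure S).trans h, fun h _ hx => hx Z h⟩

end Sub

/-- Embeddings: morphisms `φ` whose image is a substructure and which restrict to an isomorphism
onto this image. -/
def IsEmbedding (X Y : Space.{u} σ) (φ : X → Y) : Prop :=
  IsMorphism X Y φ ∧
    ∃ (Z : Sub Y) (ψ : X → Z.toSpace), IsIso X Z.toSpace ψ ∧ ∀ x, (ψ x).1 = φ x

/-- The power `X ^ S`, with the product topology and pointwise structure. -/
def pow (X : Space.{u} σ) (S : Type u) : Space.{u} σ where
  carrier := S → X
  top := Pi.topologicalSpace
  op g x := fun t => X.op g (fun i => x i t)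
  pop h x := ⟨∀ t, (X.pop h (fun i => x i t)).Dom, fun hx t =>
    (X.pop h (fun i => x i t)).get (hx t)⟩
  rel r := {x | ∀ t, (fun i => x i t) ∈ X.rel r}

/-- The class `IS_cP⁺(X)`: isomorphic copies of closed substructures of nonempty powers of `X`,
together with the empty structure. -/
def InIScP (X : Space.{u} σ) (Y : Space.{u} σ) : Prop :=
  IsEmpty Y ∨ ∃ (S : Type u) (_ : Nonempty S) (Z : Sub (X.pow S)) (ψ : Y → Z.toSpace),
    IsClosed Z.carrier ∧ IsIso Y Z.toSpace ψ

/-- `Z` is a `Y`-substructure of `X`: it is generated by the union of the images of finitely many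
(possibly zero) morphisms from `Y` to `X`. -/
def IsYSubstructure (Y X : Space.{u} σ) (Z : Sub X) : Prop :=
  ∃ (m : ℕ) (φ : Fin m → Y → X), (∀ i, IsMorphism Y X (φ i)) ∧
    Z = Sub.closure (⋃ i, Set.range (φ i))

/-- The `Y`-substructures of `X`, ordered by inclusion. -/
def YSub (Y X : Space.{u} σ) : Type u := {Z : Sub X // IsYSubstructure Y X Z}

instance (Y X : Space.{u} σ) : PartialOrder (YSub Y X) :=
  inferInstanceAs (PartialOrder {Z : Sub X // IsYSubstructure Y X Z})

theorem isYSubstructure_sup {Y X : Space.{u} σ} {Z W : Sub X} (hZ : IsYSubstructure Y X Z)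
    (hW : IsYSubstructure Y X W) :
    IsYSubstructure Y X (Sub.closure (Z.carrier ∪ W.carrier)) := by
  obtain ⟨m, φ, hφ, rfl⟩ := hZ
  obtain ⟨n, ψ, hψ, rfl⟩ := hW
  refine ⟨m + n, Fin.append φ ψ, ?_, ?_⟩
  · intro i
    refine Fin.addCases (fun i => ?_) (fun i => ?_) i
    · simpa using hφ i
    · simpa using hψ i
  · apply le_antisymm
    · refine Sub.closure_le.2 (Set.union_subset ?_ ?_)
      · refine Sub.closure_le.2 (Set.iUnion_subset fun i => ?_)
        refine Set.Subset.trans ?_ (Sub.subset_closure _)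
        refine Set.Subset.trans ?_ (Set.subset_iUnion _ (Fin.castAdd n i))
        simp
      · refine Sub.closure_le.2 (Set.iUnion_subset fun i => ?_)
        refine Set.Subset.trans ?_ (Sub.subset_closure _)
        refine Set.Subset.trans ?_ (Set.subset_iUnion _ (Fin.natAdd m i))
        simp
    · refine Sub.closure_le.2 (Set.iUnion_subset fun i => ?_)
      refine Set.Subset.trans ?_ (Sub.subset_closure _)
      refine Fin.addCases (fun i => ?_) (fun i => ?_) i
      · rw [Fin.append_left]
        exact Set.Subset.trans (Set.Subset.trans (Set.subset_iUnion (fun i => Set.range (φ i)) i)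
          (Sub.subset_closure _)) Set.subset_union_left
      · rw [Fin.append_right]
        exact Set.Subset.trans (Set.Subset.trans (Set.subset_iUnion (fun i => Set.range (ψ i)) i)
          (Sub.subset_closure _)) Set.subset_union_right

/-- The join of two `Y`-substructures is the substructure generated by their union. -/
instance (Y X : Space.{u} σ) : SemilatticeSup (YSub Y X) where
  sup Z W := ⟨Sub.closure (Z.1.carrier ∪ W.1.carrier), isYSubstructure_sup Z.2 W.2⟩
  le_sup_left _ _ := Set.Subset.trans Set.subset_union_left (Sub.subset_closure _)
  le_sup_right _ _ := Set.Subset.trans Set.subset_union_right (Sub.subset_closure _)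
  sup_le _ _ _ h₁ h₂ := Sub.closure_le.2 (Set.union_subset h₁ h₂)

end Space

/-! ### Alter egos and the hom-functors `D` and `E` -/

/-- An alter ego for the algebra `M`: total operations that are homomorphisms `M ^ n → M`, partial
operations that are homomorphisms from subalgebras of `M ^ n` to `M`, and relations that are
subalgebras of `M ^ n`. (The topology is the discrete one, see `AlterEgo.space`.) -/
structure AlterEgo (L : FirstOrder.Language.{v, w}) (M : Type u) [L.Structure M] (σ : Signature.{s}) where
  op : ∀ g : σ.G, (Fin (σ.arG g) → M) →[L] M
  dom : ∀ h : σ.H, L.Substructure (Fin (σ.arH h) → M)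
  pop : ∀ h : σ.H, dom h →[L] M
  rel : ∀ r : σ.R, L.Substructure (Fin (σ.arR r) → M)

namespace AlterEgo

variable {L : FirstOrder.Language.{v, w}} [L.IsAlgebraic] {M : Type u} [L.Structure M] {σ : Signature.{s}}

/-- The alter ego as a structured space, discretely topologised. -/
def space (T : AlterEgo L M σ) : Space.{u} σ where
  carrier := M
  top := ⊥
  op g := T.op g
  pop h x := ⟨x ∈ T.dom h, fun hx => T.pop h ⟨x, hx⟩⟩
  rel r := T.rel r

/-- The set of homomorphisms `A → M` as a substructure of the power of the alter ego with index
set `A`. -/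
def homSub (T : AlterEgo L M σ) (A : Type u) [L.Structure A] : Space.Sub (T.space.pow A) where
  carrier := {x : A → M | ∃ φ : A →[L] M, ⇑φ = x}
  op_mem g x hx := by
    choose φ hφ using hx
    refine ⟨⟨fun a => T.op g (fun i => φ i a), fun F a => ?_, fun r => isEmptyElim r⟩, ?_⟩
    · have h : (fun i => φ i (FirstOrder.Language.Structure.funMap F a)) =
          FirstOrder.Language.Structure.funMap F (fun k i => φ i (a k)) := by
        funext i
        exact (φ i).map_fun F a
      rw [h]
      exact (T.op g).map_fun F _
    · funext a
      exact congrArg (T.op g) (funext fun i => congrFun (hφ i) a)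
  pop_mem h x hx y hy := by
    choose φ hφ using hx
    obtain ⟨hd, rfl⟩ := hy
    have hd' : ∀ a, (fun i => φ i a) ∈ T.dom h := fun a => by
      have := hd a
      rwa [show (fun i => φ i a) = (fun i => x i a) from funext fun i => congrFun (hφ i) a]
    refine ⟨⟨fun a => T.pop h ⟨fun i => φ i a, hd' a⟩, fun F a => ?_, fun r => isEmptyElim r⟩, ?_⟩
    · have e : (⟨fun i => φ i (FirstOrder.Language.Structure.funMap F a), hd' _⟩ : T.dom h) =
          FirstOrder.Language.Structure.funMap F (fun k => ⟨fun i => φ i (a k), hd' (a k)⟩) := by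
        apply Subtype.ext
        funext i
        exact (φ i).map_fun F a
      rw [e]
      exact (T.pop h).map_fun F _
    · funext a
      exact congrArg (T.pop h) (Subtype.ext (funext fun i => congrFun (hφ i) a))

/-- The dual space `D(A)`: the set of homomorphisms `A → M`, as a substructure of a power of the
alter ego. -/
def D (T : AlterEgo L M σ) (A : Type u) [L.Structure A] : Space.{u} σ := (T.homSub A).toSpace

/-- The algebra `E(X)`: the set of morphisms from `X` to the alter ego, as a subalgebra of
`M ^ X`. -/
def E (T : AlterEgo L M σ) (X : Space.{u} σ) : L.Substructure (X → M) where
  carrier := {f | Space.IsMorphism X T.space f}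
  fun_mem {n} F f hf := by
    have hf' : ∀ k, Space.IsMorphism X T.space (f k) := hf
    refine ⟨?_, fun g x => ?_, fun h x y hy => ?_, fun r x hx => ?_⟩
    · let _ : TopologicalSpace M := ⊥
      have _ : DiscreteTopology M := ⟨rfl⟩
      exact (continuous_of_discreteTopology (f := fun z : Fin n → M =>
        FirstOrder.Language.Structure.funMap F z)).comp (continuous_pi fun k => (hf' k).continuous)
    · have h : (fun k => f k (X.op g x)) = fun k => T.op g (f k ∘ x) :=
        funext fun k => (hf' k).map_op g x
      change FirstOrder.Language.Structure.funMap F (fun k => f k (X.op g x)) = _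
      rw [h]
      exact ((T.op g).map_fun F (fun k => f k ∘ x)).symm
    · have hm := fun k => (hf' k).map_pop h x y hy
      have hd : ∀ k, f k ∘ x ∈ T.dom h := fun k => (hm k).1
      have hv : ∀ k, T.pop h ⟨f k ∘ x, hd k⟩ = f k y := fun k => (hm k).2
      refine ⟨(T.dom h).fun_mem F (fun k => f k ∘ x) hd, ?_⟩
      change T.pop h (FirstOrder.Language.Structure.funMap F (fun k => (⟨f k ∘ x, hd k⟩ : T.dom h))) = _
      rw [(T.pop h).map_fun F]
      exact congrArg (FirstOrder.Language.Structure.funMap F) (funext hv)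
    · exact (T.rel r).fun_mem F (fun k => f k ∘ x) (fun k => (hf' k).map_rel r x hx)

/-- The evaluation map `e_A : A → E(D(A))`, `a ↦ (x ↦ x(a))`. -/
def evalAlg (T : AlterEgo L M σ) (A : Type u) [L.Structure A] (a : A) : T.E (T.D A) :=
  ⟨fun x => x.1 a, by
    refine ⟨?_, fun g x => rfl, fun h x y hy => ?_, fun r x hx => hx a⟩
    · let _ : TopologicalSpace M := ⊥
      exact (continuous_apply (A := fun _ : A => M) a).comp continuous_subtype_val
    · obtain ⟨hd, rfl⟩ := hy
      exact ⟨hd a, rfl⟩⟩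

/-- The evaluation map `ε_X : X → D(E(X))`, `x ↦ (f ↦ f(x))`. -/
def evalSpace (T : AlterEgo L M σ) (X : Space.{u} σ) (x : X) : T.D (T.E X) :=
  ⟨fun f => f.1 x, ⟨⟨fun f => f.1 x, fun _ _ => rfl, fun r => isEmptyElim r⟩, rfl⟩⟩

/-- The alter ego yields a duality on `ISP(M)`: every `e_A` is surjective. (The maps `e_A` and
`ε_X` are always embeddings.) -/
def YieldsDuality (T : AlterEgo L M σ) : Prop :=
  ∀ (A : Type u) [L.Structure A], InISP L M A → Function.Surjective (T.evalAlg A)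

/-- The alter ego yields a full duality: in addition, every `ε_X` is surjective. -/
def YieldsFullDuality (T : AlterEgo L M σ) : Prop :=
  T.YieldsDuality ∧
    ∀ X : Space.{u} σ, Space.InIScP T.space X → Function.Surjective (T.evalSpace X)

/-- The alter ego is injective in the dual category, with respect to embeddings. -/
def IsInjective (T : AlterEgo L M σ) : Prop :=
  ∀ X Y : Space.{u} σ, Space.InIScP T.space X → Space.InIScP T.space Y →
    ∀ φ : X → Y, Space.IsEmbedding X Y φ →
      ∀ α : X → T.space, Space.IsMorphism X T.space α →
        ∃ β : Y → T.space, Space.IsMorphism Y T.space β ∧ β ∘ φ = α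

/-- The alter ego yields a strong duality: the duality is full (so that the two categories are
dually equivalent) and the alter ego is injective in the dual category. -/
def YieldsStrongDuality (T : AlterEgo L M σ) : Prop :=
  T.YieldsFullDuality ∧ T.IsInjective

end AlterEgo

end NatDual

/-! Let r : B → E(X) send b to the restriction to X of evaluation at b. For a homomorphism p : E(X)
→ B, the map D(p ∘ r) is an endomorphism of D(B). By fullness each w ∘ p is evaluation at a point of
X, so the image of D(p ∘ r) lies in X, and f at the image of w is w(p f).

Suppose a set P of such p separates the points of E(X), and let Z ≤ X be generated by the images of
all D(p ∘ r), p ∈ P. Elements of E(X) agreeing on Z have equal images under every p ∈ P, so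
restriction E(X) → E(Z) is injective. It is onto because the alter ego is injective, and fullness
then gives Z = X (`le_of_eqOn_imp_eq`). Join-irreducibility leaves a single p whose image generates
X, and that p is injective (`exists_injective_of_supIrred`).

This is used twice. Taking all homomorphisms E(X) → B gives E(X) ∈ ISP(B). Taking those that factor
through a component of a subdirect representation makes one projection injective, hence an
isomorphism. -/

namespace NatDual

open FirstOrder.Language

/-! ### Homomorphisms and membership in ISP. -/

section Homs

variable {L : FirstOrder.Language.{v, w}}

/-- The coordinate projections of a product are homomorphisms. -/
def projHom {ι : Type*} (C : ι → Type*) [∀ i, L.Structure (C i)] (i : ι) :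
    (∀ i, C i) →[L] C i where
  toFun a := a i
  map_fun' _ _ := rfl
  map_rel' _ _ h := h i

/-- The members of `ISP(B)` are separated by homomorphisms into `B`. -/
theorem InISP.eq_of_forall_hom {B C : Type u} [L.Structure B] [L.Structure C]
    (hC : InISP L B C) {a b : C} (h : ∀ g : C →[L] B, g a = g b) : a = b := by
  obtain ⟨-, I, S, ⟨e⟩⟩ := hC
  refine e.injective (Subtype.ext (funext fun i => ?_))
  exact h (((projHom (fun _ : I => B) i).comp S.subtype.toHom).comp e.toHom)

variable [L.IsAlgebraic]

/-- For an algebraic language, an injective homomorphism is an embedding. -/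
def embeddingOfInjective {A B : Type*} [L.Structure A] [L.Structure B] (g : A →[L] B)
    (hg : Function.Injective g) : A ↪[L] B where
  toFun := g
  inj' := hg
  map_fun' := g.map_fun
  map_rel' r := isEmptyElim r

/-- For an algebraic language, a bijective homomorphism is an isomorphism. -/
noncomputable def equivOfBijective {A B : Type*} [L.Structure A] [L.Structure B] (g : A →[L] B)
    (hg : Function.Bijective g) : A ≃[L] B where
  toEquiv := Equiv.ofBijective g hg
  map_fun' := g.map_fun
  map_rel' r := isEmptyElim r

/-- An algebra with an injective homomorphism into `B` belongs to `ISP(B)`. -/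
theorem InISP.of_injective {A B : Type u} [L.Structure A] [L.Structure B] [Nonempty A]
    (g : A →[L] B) (hg : Function.Injective g) : InISP L B A := by
  let d : A →[L] (PUnit.{u + 1} → B) :=
    { toFun := fun a _ => g a
      map_fun' := fun F x => funext fun _ => g.map_fun F x
      map_rel' := fun r => isEmptyElim r }
  refine ⟨inferInstance, PUnit, _, ⟨(embeddingOfInjective d fun a b h => hg ?_).equivRange⟩⟩
  exact congrFun h PUnit.unit

end Homs

/-! ### Generation of substructures and join-irreducibility. -/

namespace Space

variable {σ : Signature.{s}}

theorem IsMorphism.comp {X Y Z : Space.{u} σ} {g : Y → Z} {f : X → Y} (hg : IsMorphism Y Z g)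
    (hf : IsMorphism X Y f) : IsMorphism X Z (g ∘ f) where
  continuous := hg.continuous.comp hf.continuous
  map_op G x := by
    rw [Function.comp_apply, hf.map_op, hg.map_op]; rfl
  map_pop h x y hy := hg.map_pop h _ _ (hf.map_pop h x y hy)
  map_rel r x hx := hg.map_rel r _ (hf.map_rel r x hx)

namespace Sub

variable {X : Space.{u} σ}

/-- The inclusion map between two substructures. -/
def incl {Z W : Sub X} (h : Z ≤ W) (z : Z.toSpace) : W.toSpace := ⟨z.1, h z.2⟩

theorem isMorphism_val (Z : Sub X) : IsMorphism Z.toSpace X (fun z => z.1) := by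
  refine ⟨continuous_subtype_val, fun g x => rfl, fun h x y hy => ?_, fun r x hx => hx⟩
  obtain ⟨hd, rfl⟩ := hy
  exact ⟨hd, rfl⟩

/-- A morphism whose image lies in a substructure corestricts to it. -/
theorem isMorphism_codRestrict {Y : Space.{u} σ} {f : Y → X} (hf : IsMorphism Y X f) {Z : Sub X}
    (h : ∀ y, f y ∈ Z.carrier) : IsMorphism Y Z.toSpace (fun y => ⟨f y, h y⟩) := by
  refine ⟨Continuous.subtype_mk (f := f) hf.continuous h, fun g x => Subtype.ext (hf.map_op g x),
    fun k x y hy => ?_, fun r x hx => hf.map_rel r x hx⟩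
  obtain ⟨hd, he⟩ := hf.map_pop k x y hy
  exact ⟨hd, Subtype.ext he⟩

theorem isMorphism_incl {Z W : Sub X} (h : Z ≤ W) :
    IsMorphism Z.toSpace W.toSpace (incl h) :=
  isMorphism_codRestrict Z.isMorphism_val fun z => h z.2

/-- A substructure of a substructure, as a substructure of the ambient space. -/
def ofSub {Z : Sub X} (W : Sub Z.toSpace) : Sub X where
  carrier := {x | ∃ h : x ∈ Z.carrier, (⟨x, h⟩ : Z.carrier) ∈ W.carrier}
  op_mem g x hx := by
    choose h h' using hx
    exact ⟨Z.op_mem g x h, W.op_mem g (fun i => ⟨x i, h i⟩) h'⟩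
  pop_mem k x hx y hy := by
    choose h h' using hx
    refine ⟨Z.pop_mem k x h y hy, W.pop_mem k (fun i => ⟨x i, h i⟩) h' _ ?_⟩
    obtain ⟨hd, rfl⟩ := hy
    exact ⟨hd, rfl⟩

/-- Two morphisms on the substructure generated by a set are equal if they agree on this set. -/
theorem eq_of_eqOn_generators {Y : Space.{u} σ} {Z : Sub X} {S : Set X} (hZ : Z = closure S)
    {f g : Z.toSpace → Y} (hf : IsMorphism Z.toSpace Y f) (hg : IsMorphism Z.toSpace Y g)
    (h : ∀ z, z.1 ∈ S → f z = g z) : f = g := by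
  -- The equalizer of f and g is a substructure. For a partial operation, both morphisms send its
  -- value to the value at the same tuple of Y, which is unique.
  let W : Sub Z.toSpace :=
    { carrier := {x | f x = g x}
      op_mem := fun G x hx => by
        have e : f ∘ x = g ∘ x := funext hx
        change f _ = g _
        rw [hf.map_op, hg.map_op, e]
      pop_mem := fun k x hx y hy => by
        have e : f ∘ x = g ∘ x := funext hx
        have h₁ := hf.map_pop k x y hy
        rw [e] at h₁
        exact Part.mem_unique h₁ (hg.map_pop k x y hy) }
  have hS : S ⊆ Z.carrier := hZ ▸ subset_closure S
  have hle : Z ≤ ofSub W := by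
    have : closure S ≤ ofSub W := closure_le.2 fun x hx => ⟨hS hx, h ⟨x, hS hx⟩ hx⟩
    exact hZ.trans_le this
  exact funext fun z => (hle z.2).2

theorem ofSub_isIso {Z : Sub X} (W : Sub Z.toSpace) :
    IsIso W.toSpace (ofSub W).toSpace (fun z => ⟨z.1.1, z.1.2, z.2⟩) := by
  refine ⟨isMorphism_codRestrict (Z.isMorphism_val.comp W.isMorphism_val) _,
    fun x => ⟨⟨x.1, x.2.fst⟩, x.2.snd⟩, ?_, fun _ => rfl, fun _ => rfl⟩
  exact isMorphism_codRestrict (isMorphism_codRestrict (ofSub W).isMorphism_val _) _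

/-- The inclusion map between two substructures is an embedding. -/
theorem isEmbedding_incl {Z W : Sub X} (h : Z ≤ W) :
    IsEmbedding Z.toSpace W.toSpace (incl h) := by
  let V : Sub W.toSpace :=
    { carrier := {x | x.1 ∈ Z.carrier}
      op_mem := fun g x hx => Z.op_mem g (fun i => (x i).1) hx
      pop_mem := fun k x hx y hy =>
        Z.pop_mem k (fun i => (x i).1) hx y.1 (W.isMorphism_val.map_pop k x y hy) }
  refine ⟨isMorphism_incl h, V, fun z => ⟨incl h z, z.2⟩,
    ⟨isMorphism_codRestrict (isMorphism_incl h) _, fun x => ⟨x.1.1, x.2⟩, ?_,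
      fun _ => rfl, fun _ => rfl⟩, fun _ => rfl⟩
  exact isMorphism_codRestrict (W.isMorphism_val.comp V.isMorphism_val) _

theorem closure_union (S S' : Set X) :
    closure ((closure S).carrier ∪ (closure S').carrier) = closure (S ∪ S') := by
  apply le_antisymm
  · refine closure_le.2 (Set.union_subset ?_ ?_)
    · exact closure_le.2 (Set.subset_union_left.trans (subset_closure _))
    · exact closure_le.2 (Set.subset_union_right.trans (subset_closure _))
  · exact closure_le.2 (Set.union_subset_union (subset_closure _) (subset_closure _) |>.trans
      (subset_closure _))

end Sub

/-- The substructure generated by the images of a finite set of morphisms from `Y` is a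
`Y`-substructure. -/
theorem isYSubstructure_closure_biUnion {Y X : Space.{u} σ} {Φ : Set (Y → X)} (hfin : Φ.Finite)
    (hΦ : ∀ φ ∈ Φ, IsMorphism Y X φ) :
    IsYSubstructure Y X (Sub.closure (⋃ φ ∈ Φ, Set.range φ)) := by
  have := hfin.to_subtype
  obtain ⟨n, ⟨e⟩⟩ := Finite.exists_equiv_fin Φ
  refine ⟨n, fun i => (e.symm i).1, fun i => hΦ _ (e.symm i).2, ?_⟩
  rw [Set.biUnion_eq_iUnion, ← e.symm.surjective.iUnion_comp]

/-- If a join-irreducible `Y`-substructure is generated by the images of finitely many morphisms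
from `Y`, it is generated by the image of one of them. -/
theorem exists_eq_closure_range {Y X : Space.{u} σ} {Z : YSub Y X} (hZ : SupIrred Z)
    {Φ : Set (Y → X)} (hfin : Φ.Finite) (hΦ : ∀ φ ∈ Φ, IsMorphism Y X φ)
    (hgen : Z.1 = Sub.closure (⋃ φ ∈ Φ, Set.range φ)) :
    ∃ φ ∈ Φ, Z.1 = Sub.closure (Set.range φ) := by
  induction Φ, hfin using Set.Finite.induction_on with
  | empty =>
    -- The empty set generates the least element, which join-irreducibility excludes.
    refine absurd (fun W _ => ?_) hZ.1
    change Z.1 ≤ W.1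
    rw [hgen]
    exact Sub.closure_le.2 (by simp)
  | @insert φ Φ _ hfin ih =>
    have h₁ : IsYSubstructure Y X (Sub.closure (Set.range φ)) := by
      have := isYSubstructure_closure_biUnion (Set.finite_singleton φ) (Y := Y) (X := X)
        fun ψ hψ => hΦ ψ (hψ ▸ Set.mem_insert _ _)
      simpa using this
    have h₂ := isYSubstructure_closure_biUnion hfin fun ψ hψ => hΦ ψ (Set.mem_insert_of_mem _ hψ)
    have h : (⟨_, h₁⟩ ⊔ ⟨_, h₂⟩ : YSub Y X) = Z := by
      refine Subtype.ext ?_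
      rw [hgen, Set.biUnion_insert]
      exact Sub.closure_union _ _
    rcases hZ.2 h with h | h
    · exact ⟨φ, Set.mem_insert _ _, (congrArg Subtype.val h).symm⟩
    · obtain ⟨ψ, hψ, e⟩ := ih (fun ψ hψ => hΦ ψ (Set.mem_insert_of_mem _ hψ))
        (congrArg Subtype.val h).symm
      exact ⟨ψ, Set.mem_insert_of_mem _ hψ, e⟩

end Space

/-! ### The functors D and E, and separating families of homomorphisms. -/

namespace AlterEgo

open Space

variable {L : FirstOrder.Language.{v, w}} [L.IsAlgebraic] {M : Type u} [L.Structure M]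
  {σ : Signature.{s}} (T : AlterEgo L M σ)

/-- The evaluation map `e_A` as a homomorphism. -/
def evalAlgHom (A : Type u) [L.Structure A] : A →[L] T.E (T.D A) where
  toFun := T.evalAlg A
  map_fun' F a := Subtype.ext (funext fun x => by
    obtain ⟨_, φ, rfl⟩ := x
    exact φ.map_fun F a)
  map_rel' r := isEmptyElim r

/-- Since `YieldsDuality` records only surjectivity of the evaluations, injectivity has to come from
separation by homomorphisms into M. -/
theorem evalAlgHom_injective {A : Type u} [L.Structure A] (hA : InISP L M A) :
    Function.Injective (T.evalAlgHom A) := fun _ _ h =>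
  hA.eq_of_forall_hom fun φ => congrFun (congrArg Subtype.val h) ⟨⇑φ, φ, rfl⟩

/-- The homomorphism `E(φ) : E(Y) → E(X)` induced by a morphism `φ : X → Y`. -/
def mapE {X Y : Space.{u} σ} {φ : X → Y} (hφ : IsMorphism X Y φ) : T.E Y →[L] T.E X where
  toFun f := ⟨f.1 ∘ φ, IsMorphism.comp f.2 hφ⟩
  map_fun' _ _ := rfl
  map_rel' r := isEmptyElim r

/-- Evaluation at a point, as a homomorphism `E(X) → M`. -/
def evalHom (X : Space.{u} σ) (x : X) : T.E X →[L] M where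
  toFun f := f.1 x
  map_fun' _ _ := rfl
  map_rel' r := isEmptyElim r

/-- The map `D(p) : D(A) → D(B)` induced by a homomorphism `p : B → A`. -/
def mapD {A B : Type u} [L.Structure A] [L.Structure B] (p : B →[L] A) (x : T.D A) : T.D B :=
  ⟨x.1 ∘ p, by
    obtain ⟨_, φ, rfl⟩ := x
    exact ⟨φ.comp p, rfl⟩⟩

theorem isMorphism_mapD {A B : Type u} [L.Structure A] [L.Structure B] (p : B →[L] A) :
    IsMorphism (T.D A) (T.D B) (T.mapD p) := by
  refine ⟨?_, fun _ _ => rfl, fun h x y hy => ?_, fun r x hx b => hx (p b)⟩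
  · let _ : TopologicalSpace M := ⊥
    refine Continuous.subtype_mk (f := fun x : T.D A => (x.1 ∘ p : B → M)) ?_ _
    exact continuous_pi fun b =>
      (continuous_apply (A := fun _ : A => M) (p b)).comp continuous_subtype_val
  · obtain ⟨hd, rfl⟩ := hy
    exact ⟨fun b => hd (p b), rfl⟩

theorem finite_D [Finite M] (B : Type u) [L.Structure B] [Finite B] : Finite (T.D B) :=
  have : Finite (B → M) := Pi.finite
  Subtype.finite (α := B → M)

/-- Flattened, Z is a subset of the finite discrete power M^B, hence closed. This makes fullness and
injectivity of the alter ego applicable to every substructure of D(B). -/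
theorem inIScP_sub [Finite M] {B : Type u} [L.Structure B] [Finite B] [Nonempty B]
    (Z : Space.Sub (T.D B)) : InIScP T.space Z.toSpace := by
  refine Or.inr ⟨B, inferInstance, Space.Sub.ofSub (Z := T.homSub B) Z, _, ?_, Space.Sub.ofSub_isIso Z⟩
  let _ : TopologicalSpace M := ⊥
  have _ : DiscreteTopology M := ⟨rfl⟩
  exact Set.Finite.isClosed (X := B → M) (Set.toFinite _)

variable {B : Type u} [L.Structure B]

/-- The composite of `e_B` with the restriction to a substructure of `D(B)`. -/
def restrictEval (X : Space.Sub (T.D B)) : B →[L] T.E X.toSpace :=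
  (T.mapE X.isMorphism_val).comp (T.evalAlgHom B)

variable {T}

/-- A substructure of `D(B)` on which the morphisms into the alter ego are determined by their
restrictions to a smaller substructure is equal to the latter. -/
theorem le_of_eqOn_imp_eq [Finite M] [Finite B] [Nonempty B] (hT : T.YieldsStrongDuality)
    {X Z : Space.Sub (T.D B)} (h : Z ≤ X)
    (hinj : ∀ f g : T.E X.toSpace, (∀ z (hz : z ∈ Z.carrier),
      f.1 ⟨z, h hz⟩ = g.1 ⟨z, h hz⟩) → f = g) : X ≤ Z := by
  have hbij : Function.Bijective (T.mapE (Sub.isMorphism_incl h)) := by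
    refine ⟨fun f g hfg => hinj f g fun z hz => ?_, fun f => ?_⟩
    · exact congrFun (congrArg Subtype.val hfg) ⟨z, hz⟩
    · obtain ⟨β, hβ, e⟩ := hT.2 _ _ (T.inIScP_sub Z) (T.inIScP_sub X) _
        (Sub.isEmbedding_incl h) f.1 f.2
      exact ⟨⟨β, hβ⟩, Subtype.ext e⟩
  let e := equivOfBijective _ hbij
  intro x hx
  -- Evaluation at x, transported along E(Z) ≅ E(X), is a homomorphism E(Z) → M, so fullness
  -- represents it by a point z of Z.
  obtain ⟨z, hz⟩ := hT.1.2 _ (T.inIScP_sub Z)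
    ⟨_, (T.evalHom X.toSpace ⟨x, hx⟩).comp e.symm.toHom, rfl⟩
  -- Points of D(B) are maps on B, and their value at b is read off by evaluation at b, whose
  -- restrictions to X and Z correspond under the isomorphism.
  have key : ∀ b, z.1.1 b = x.1 b := fun b => by
    have h₁ : e.symm (T.restrictEval Z b) = T.restrictEval X b := by
      rw [show T.restrictEval Z b = e (T.restrictEval X b) from rfl]
      exact e.symm_apply_apply _
    refine (congrFun (congrArg Subtype.val hz) (T.restrictEval Z b)).trans ?_
    change (e.symm (T.restrictEval Z b)).1 ⟨x, hx⟩ = _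
    rw [h₁]
    rfl
  have : z.1 = x := Subtype.ext (funext key)
  exact this ▸ z.2

/-- For a homomorphism `p : E(X) → B`, where `X` is a substructure of `D(B)`, the endomorphism
`D(p ∘ r)` of `D(B)`, where `r` is the restriction map `B → E(X)`, maps `D(B)` into `X`; the value
at `w` is the point of `X` at which evaluation is `w ∘ p`. -/
theorem exists_mapD_restrictEval [Finite M] [Finite B] [Nonempty B] (hT : T.YieldsFullDuality)
    {X : Space.Sub (T.D B)} (p : T.E X.toSpace →[L] B) (w : T.D B) :
    ∃ hx : T.mapD (p.comp (T.restrictEval X)) w ∈ X.carrier,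
      ∀ f : T.E X.toSpace, f.1 ⟨_, hx⟩ = w.1 (p f) := by
  obtain ⟨x, hx⟩ := hT.2 _ (T.inIScP_sub X) (T.mapD p w)
  have hx' : ∀ f : T.E X.toSpace, f.1 x = w.1 (p f) := fun f =>
    congrFun (congrArg Subtype.val hx) f
  -- Testing x on the restricted evaluations identifies it as a point of D(B).
  have e : T.mapD (p.comp (T.restrictEval X)) w = x.1 :=
    Subtype.ext (funext fun b => (hx' (T.restrictEval X b)).symm)
  have hmem : T.mapD (p.comp (T.restrictEval X)) w ∈ X.carrier := e ▸ x.2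
  have hpt : (⟨_, hmem⟩ : X.toSpace) = x := Subtype.ext (a1 := ⟨_, hmem⟩) e
  exact ⟨hmem, fun f => (congrArg f.1 hpt).trans (hx' f)⟩

/-- If `X` is a join-irreducible `D(B)`-substructure of `D(B)` and the points of `E(X)` are
separated by a family of homomorphisms into `B`, then one of these is injective. -/
theorem exists_injective_of_supIrred [Finite M] [Finite B] (hT : T.YieldsStrongDuality)
    (hB : InISP L M B) {X : YSub (T.D B) (T.D B)} (hX : SupIrred X)
    {P : Set (T.E X.1.toSpace →[L] B)} (hP : ∀ f g, (∀ p ∈ P, p f = p g) → f = g) :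
    ∃ p ∈ P, Function.Injective p := by
  have := hB.1
  have := T.finite_D B
  let ψ : (T.E X.1.toSpace →[L] B) → T.D B → T.D B :=
    fun p => T.mapD (p.comp (T.restrictEval X.1))
  have hψ := exists_mapD_restrictEval hT.1 (X := X.1)
  have hle : Sub.closure (⋃ φ ∈ ψ '' P, Set.range φ) ≤ X.1 := by
    refine Sub.closure_le.2 ?_
    simp only [Set.iUnion_subset_iff, Set.forall_mem_image]
    rintro p - _ ⟨w, rfl⟩
    exact (hψ p w).1
  have hgen : X.1 = Sub.closure (⋃ φ ∈ ψ '' P, Set.range φ) := by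
    refine le_antisymm (le_of_eqOn_imp_eq hT hle fun f g hfg => hP f g fun p hp => ?_) hle
    refine hB.eq_of_forall_hom fun v => ?_
    obtain ⟨hx, e⟩ := hψ p ⟨⇑v, v, rfl⟩
    refine (e f).symm.trans (Eq.trans (hfg _ (Sub.subset_closure _ ?_)) (e g))
    exact Set.mem_biUnion (Set.mem_image_of_mem ψ hp) ⟨_, rfl⟩
  -- D(B) has only finitely many self-maps, so the generating family is finite.
  obtain ⟨_, ⟨p, hp, rfl⟩, hX'⟩ := exists_eq_closure_range hX (Set.toFinite _)
    (by rintro _ ⟨p, -, rfl⟩; exact T.isMorphism_mapD _) hgen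
  refine ⟨p, hp, fun f g hfg => ?_⟩
  refine Subtype.ext (Space.Sub.eq_of_eqOn_generators hX' f.2 g.2 ?_)
  rintro ⟨_, hz⟩ ⟨w, rfl⟩
  obtain ⟨hx, e⟩ := hψ p w
  exact (e f).trans ((congrArg w.1 hfg).trans (e g).symm)

/-- The algebra `E(X)` is separated by homomorphisms into `B` if `X` is a `D(B)`-substructure of
`D(B)`. -/
theorem eq_of_forall_hom_of_ySub (hT : T.YieldsDuality) (hB : InISP L M B)
    (X : YSub (T.D B) (T.D B)) {f g : T.E X.1.toSpace}
    (h : ∀ p : T.E X.1.toSpace →[L] B, p f = p g) : f = g := by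
  obtain ⟨m, φ, hφ, hX⟩ := X.2
  let e := equivOfBijective (T.evalAlgHom B) ⟨T.evalAlgHom_injective hB, hT B hB⟩
  have hmem : ∀ i w, φ i w ∈ X.1.carrier := fun i w => by
    rw [hX]
    exact Space.Sub.subset_closure _ (Set.mem_iUnion.2 ⟨i, w, rfl⟩)
  refine Subtype.ext (Space.Sub.eq_of_eqOn_generators hX f.2 g.2 ?_)
  rintro ⟨z, hz⟩ hz'
  obtain ⟨i, w, rfl⟩ := Set.mem_iUnion.1 hz'
  -- E(φ i) followed by E(D(B)) ≅ B is a homomorphism into B, so f and g agree on the image of φ i.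
  have := e.symm.injective (h (e.symm.toHom.comp
    (T.mapE (Space.Sub.isMorphism_codRestrict (hφ i) (hmem i)))))
  exact congrFun (congrArg Subtype.val this) w

end AlterEgo

end NatDual

theorem corollary5p4 {L : FirstOrder.Language.{v, w}} [L.IsAlgebraic]
    {M : Type u} [L.Structure M] [Finite M] [Nonempty M]
    {σ : NatDual.Signature.{s}} (T : NatDual.AlterEgo L M σ) (hT : T.YieldsStrongDuality)
    (B : Type u) [L.Structure B] [Finite B] (hB : NatDual.InISP L M B)
    (X : NatDual.Space.YSub (T.D B) (T.D B)) (hX : SupIrred X) :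
    NatDual.IsSubdirectlyIrreducible (fun (C : Type u) [L.Structure C] => NatDual.InISP L B C)
      (T.E X.1.toSpace) := by
  have := hB.1
  obtain ⟨p, -, hp⟩ := NatDual.AlterEgo.exists_injective_of_supIrred hT hB hX (P := Set.univ)
    fun f g h => NatDual.AlterEgo.eq_of_forall_hom_of_ySub hT.1.1 hB X fun p => h p trivial
  have : Nonempty (T.E X.1.toSpace) := ⟨T.restrictEval X.1 (Classical.arbitrary B)⟩
  refine ⟨NatDual.InISP.of_injective p hp, fun ι C _ hC f hf => ?_⟩
  let q (i : ι) : T.E X.1.toSpace →[L] C i := (NatDual.projHom C i).comp f.toHom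
  -- Each component lies in ISP(B), so the composites E(X) → C i → B separate points. An empty
  -- family is covered too, since the lemma produces an index.
  obtain ⟨_, ⟨⟨i, r⟩, rfl⟩, hr⟩ := NatDual.AlterEgo.exists_injective_of_supIrred hT hB hX
    (P := Set.range fun a : Σ i, C i →[L] B => a.2.comp (q a.1)) fun a b hab => by
      refine f.injective (funext fun i => (hC i).eq_of_forall_hom fun r => ?_)
      exact hab _ ⟨⟨i, r⟩, rfl⟩
  have hq : Function.Injective (q i) := Function.Injective.of_comp (f := r) hr
  exact ⟨i, ⟨NatDual.equivOfBijective (q i) ⟨hq, hf i⟩⟩⟩
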